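/- Let $n\ge 2$ and let $\omega\in L^1\cap L^\infty(\mathbb{R}^n)$ be real-valued with compact (essential) support $\operatorname{supp}(\omega)$, i.e. the complement of the largest open set on which $\omega=0$ almost everywhere is compact. Assume $\int_{\mathbb{R}^n}\omega\,dx=0$, and let $\Omega$ be the unbounded connected component of $\operatorname{supp}(\omega)^c$. Let $$\mathcal{N}(x)=\begin{cases}\dfrac{1}{2\pi}\log|x| & \text{if } n=2,\\[2mm] \dfrac{1}{n(2-n)V_n}|x|^{2-n},\quad V_n=\dfrac{\pi^{n/2}}{\Gamma(\frac n2+1)} & \text{if } n>2,\end{cases}$$ and let $f=\omega*\mathcal{N}$, that is, $f(x)=\int_{\mathbb{R}^n}\omega(y)\,\mathcal{N}(x-y)\,dy$; this integral converges absolutely for every $x\in\mathbb{R}^n$. (a) If $\omega$ is not almost everywhere zero, then $f$ attains a maximum and a minimum on $\partial\Omega$, and $$\sup_{x\in\Omega}f(x)=\max_{x\in\partial\Omega}f(x)\qquad\text{and}\qquad \inf_{x\in\Omega}f(x)=\min_{x\in\partial\Omega}f(x).$$ (b) Consequently, if $f$ is constant on $\partial\Omega$, then $f$ is constant in $\Omega$.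 (If $\omega=0$ almost everywhere, then $\Omega=\mathbb{R}^n$, $\partial\Omega=\emptyset$, and $f\equiv 0$ is constant.) -/

import Mathlib

open MeasureTheory Set Topology

/-- Volume `V_n = π^{n/2} / Γ(n/2 + 1)` of the unit ball of `ℝⁿ`. -/
noncomputable def unitBallVolume (n : ℕ) : ℝ :=
  Real.pi ^ ((n : ℝ) / 2) / Real.Gamma ((n : ℝ) / 2 + 1)

/-- The Newtonian kernel `𝒩` on `ℝⁿ`, `n ≥ 2`: `(1 / 2π) log |x|` if `n = 2`, and
`|x|^{2 - n} / (n (2 - n) V_n)` if `n > 2`.  (The value at the single point `x = 0` is immaterial.) -/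
noncomputable def newtonianKernel (n : ℕ) (x : EuclideanSpace ℝ (Fin n)) : ℝ :=
  if n = 2 then 1 / (2 * Real.pi) * Real.log ‖x‖
  else 1 / ((n : ℝ) * (2 - (n : ℝ)) * unitBallVolume n) * ‖x‖ ^ (2 - (n : ℝ))

/-- The Newtonian potential `ω * 𝒩`, i.e. `x ↦ ∫ ω(y) 𝒩(x - y) dy`. -/
noncomputable def newtonianPotential {n : ℕ} (ω : EuclideanSpace ℝ (Fin n) → ℝ) :
    EuclideanSpace ℝ (Fin n) → ℝ :=
  convolution ω (newtonianKernel n) (ContinuousLinearMap.lsmul ℝ ℝ) volume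

/-- The (essential) support of a function in `L^p(ℝⁿ)`: the complement of the largest open set on
which it vanishes almost everywhere.  It depends only on the almost-everywhere class. -/
def essentialSupport {n : ℕ} (ω : EuclideanSpace ℝ (Fin n) → ℝ) :
    Set (EuclideanSpace ℝ (Fin n)) :=
  (⋃₀ {U | IsOpen U ∧ ∀ᵐ x ∂(volume.restrict U), ω x = 0})ᶜ

/-- `Ω` is an unbounded connected component of the set `S`.  (If `S` is the complement of a
compact subset of `ℝⁿ`, `n ≥ 2`, there is exactly one such `Ω`.) -/
def IsUnboundedComponent {n : ℕ} (S Ω : Set (EuclideanSpace ℝ (Fin n))) : Prop :=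
  (∃ x ∈ S, Ω = connectedComponentIn S x) ∧ ¬ Bornology.IsBounded Ω

/-! The potential `f` is continuous, harmonic off the support, and decays like `‖x‖ ^ (1 - n)`,
because the zero mean cancels the leading term of the kernel at infinity. So `f → 0` at infinity,
and the maximum principle on `Ω` could fail only through a supremum approached at infinity, with `f
< 0` on the boundary. Comparison with `‖x‖ ^ (3 / 2 - n)` excludes this: if `f` were negative on a
large sphere it would lie below `-ε ‖x‖ ^ (3 / 2 - n)` outside it, which is incompatible with the
faster decay (`exists_mem_sphere_nonneg_of_decay`). Hence `f ≥ 0` somewhere in `Ω`, any excess over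
the boundary maximum is attained in `Ω`, and the strong maximum principle gives a contradiction.

Harmonicity is used only as the vanishing of a limit of second differences. It needs no derivatives
of `f`, passes through the integral by uniform bounds on the kernel, and still has a sign at local
maxima. That sign and a strictly subharmonic barrier yield both maximum principles. -/

open Filter

/-- The sum of the symmetric second differences of `u` at `x` with step `h` in the coordinate
directions. -/
noncomputable def discreteLaplacian {n : ℕ} (u : EuclideanSpace ℝ (Fin n) → ℝ)
    (x : EuclideanSpace ℝ (Fin n)) (h : ℝ) : ℝ :=
  ∑ i, (u (x + h • EuclideanSpace.single i 1) + u (x - h • EuclideanSpace.single i 1) - 2 * u x)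

/-- `u` has limiting discrete Laplacian `L` at `x`. -/
def HasLimitLaplacian {n : ℕ} (u : EuclideanSpace ℝ (Fin n) → ℝ)
    (x : EuclideanSpace ℝ (Fin n)) (L : ℝ) : Prop :=
  Tendsto (fun h => discreteLaplacian u x h / h ^ 2) (𝓝[>] 0) (𝓝 L)

/-! ### Taylor estimates with uniform constants -/

section Calculus

theorem abs_le_mul_abs_pow_succ {G G' : ℝ → ℝ} {r C : ℝ} {k : ℕ} (hC : 0 ≤ C)
    (hG : ∀ s, |s| ≤ r → HasDerivAt G (G' s) s) (h0 : G 0 = 0)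
    (hb : ∀ s, |s| ≤ r → |G' s| ≤ C * |s| ^ k) (s : ℝ) (hs : |s| ≤ r) :
    |G s| ≤ C * |s| ^ (k + 1) := by
  have hmem : ∀ y ∈ Icc (-|s|) |s|, |y| ≤ |s| := fun y hy => abs_le.2 hy
  have := (convex_Icc (-|s|) |s|).norm_image_sub_le_of_norm_hasDerivWithin_le
    (f := G) (f' := G') (C := C * |s| ^ k)
    (fun y hy => (hG y ((hmem y hy).trans hs)).hasDerivWithinAt)
    (fun y hy => (hb y ((hmem y hy).trans hs)).trans
      (mul_le_mul_of_nonneg_left (pow_le_pow_left₀ (abs_nonneg y) (hmem y hy) k) hC))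
    (x := 0) (y := s) (by simp) (by simp [neg_abs_le, le_abs_self])
  simpa [h0, pow_succ, mul_assoc] using this

/-- The bound on the third derivative is integrated three times by the mean value inequality; the
lost factor 1/6 is harmless. What matters is that `C` serves all `t ≥ a` at once. -/
theorem abs_taylor_two_le {F F₁ F₂ F₃ : ℝ → ℝ} {a C : ℝ} (ha : 0 < a)
    (h₁ : ∀ t, 0 < t → HasDerivAt F (F₁ t) t) (h₂ : ∀ t, 0 < t → HasDerivAt F₁ (F₂ t) t)
    (h₃ : ∀ t, 0 < t → HasDerivAt F₂ (F₃ t) t) (hb : ∀ t, a / 2 ≤ t → |F₃ t| ≤ C)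
    {t u : ℝ} (ht : a ≤ t) (hu : |u| ≤ a / 2) :
    |F (t + u) - F t - F₁ t * u - F₂ t * u ^ 2 / 2| ≤ C * |u| ^ 3 := by
  have hC : 0 ≤ C := (abs_nonneg _).trans (hb (a / 2) le_rfl)
  have hpos : ∀ s, |s| ≤ a / 2 → 0 < t + s := fun s hs => by
    have := (abs_le.1 hs).1; linarith
  have hshift : ∀ (H H' : ℝ → ℝ), (∀ t, 0 < t → HasDerivAt H (H' t) t) → ∀ s, |s| ≤ a / 2 →
      HasDerivAt (fun s => H (t + s)) (H' (t + s)) s := fun H H' hH s hs =>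
    (hH _ (hpos s hs)).comp_const_add t s
  have e₂ := abs_le_mul_abs_pow_succ (G := fun s => F₂ (t + s) - F₂ t) (k := 0) (r := a / 2) hC
    (fun s hs => (hshift F₂ F₃ h₃ s hs).sub_const _) (by simp)
    (fun s hs => by
      have := (abs_le.1 hs).1
      simpa using hb (t + s) (by linarith))
  have e₁ := abs_le_mul_abs_pow_succ (G := fun s => F₁ (t + s) - F₁ t - F₂ t * s) hC
    (fun s hs => (((hshift F₁ F₂ h₂ s hs).sub_const (F₁ t)).sub
        ((hasDerivAt_id s).const_mul (F₂ t))).congr_deriv (by simp)) (by simp) e₂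
  exact abs_le_mul_abs_pow_succ (G := fun s => F (t + s) - F t - F₁ t * s - F₂ t * s ^ 2 / 2) hC
    (fun s hs => by
      have := (((hshift F F₁ h₁ s hs).sub_const (F t)).sub
        ((hasDerivAt_id s).const_mul (F₁ t))).sub
        ((((hasDerivAt_id s).pow 2).const_mul (F₂ t)).div_const 2)
      refine this.congr_deriv ?_
      simp; ring) (by simp) e₁ u hu

end Calculus

/-! ### Discrete Laplacians and their limits -/

section Laplacian

variable {n : ℕ} {u v : EuclideanSpace ℝ (Fin n) → ℝ} {x : EuclideanSpace ℝ (Fin n)} {L M : ℝ}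

theorem HasLimitLaplacian.add (hu : HasLimitLaplacian u x L) (hv : HasLimitLaplacian v x M) :
    HasLimitLaplacian (fun y => u y + v y) x (L + M) := by
  refine (Tendsto.add hu hv).congr fun h => ?_
  rw [← add_div, discreteLaplacian, discreteLaplacian, discreteLaplacian,
    ← Finset.sum_add_distrib]
  congr 1
  exact Finset.sum_congr rfl fun i _ => by ring

theorem HasLimitLaplacian.const_mul (c : ℝ) (hu : HasLimitLaplacian u x L) :
    HasLimitLaplacian (fun y => c * u y) x (c * L) := by
  refine (Tendsto.const_mul c hu).congr fun h => ?_
  rw [← mul_div_assoc, discreteLaplacian, discreteLaplacian, Finset.mul_sum]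
  congr 1
  exact Finset.sum_congr rfl fun i _ => by ring

theorem HasLimitLaplacian.comp_sub (y : EuclideanSpace ℝ (Fin n))
    (hu : HasLimitLaplacian u (x - y) L) : HasLimitLaplacian (fun z => u (z - y)) x L := by
  refine Tendsto.congr (fun h => ?_) hu
  simp only [discreteLaplacian, add_sub_right_comm, sub_right_comm x _ y]

/-- The limiting discrete Laplacian is nonpositive at a local maximum. -/
theorem HasLimitLaplacian.nonpos_of_isLocalMax (hu : HasLimitLaplacian u x L)
    (hx : IsLocalMax u x) : L ≤ 0 := by
  refine le_of_tendsto hu ?_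
  have key : ∀ i : Fin n, ∀ᶠ h : ℝ in 𝓝[>] 0,
      u (x + h • EuclideanSpace.single i 1) + u (x - h • EuclideanSpace.single i 1)
        - 2 * u x ≤ 0 := by
    intro i
    have c₁ : Tendsto (fun h : ℝ => x + h • EuclideanSpace.single i (1 : ℝ)) (𝓝[>] 0) (𝓝 x) := by
      have : Continuous fun h : ℝ => x + h • EuclideanSpace.single i (1 : ℝ) := by fun_prop
      simpa using (this.tendsto 0).mono_left nhdsWithin_le_nhds
    have c₂ : Tendsto (fun h : ℝ => x - h • EuclideanSpace.single i (1 : ℝ)) (𝓝[>] 0) (𝓝 x) := by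
      have : Continuous fun h : ℝ => x - h • EuclideanSpace.single i (1 : ℝ) := by fun_prop
      simpa using (this.tendsto 0).mono_left nhdsWithin_le_nhds
    filter_upwards [c₁.eventually hx, c₂.eventually hx] with h h₁ h₂
    linarith
  filter_upwards [eventually_all.2 key] with h hh
  exact div_nonpos_of_nonpos_of_nonneg (Finset.sum_nonpos fun i _ => hh i) (sq_nonneg h)

/-- Uniform expansion of the discrete Laplacian of a radial function `F (‖z‖²)` whose profile has
derivative `c t ^ q`. -/
theorem exists_abs_discreteLaplacian_radial_sub_le {F : ℝ → ℝ} {c q : ℝ} (hq : q ≤ 0)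
    (hF : ∀ t, 0 < t → HasDerivAt F (c * t ^ q) t) {δ : ℝ} (hδ : 0 < δ) (B : ℝ) :
    ∃ C h₀ : ℝ, 0 < h₀ ∧ ∀ z : EuclideanSpace ℝ (Fin n), δ ≤ ‖z‖ → ‖z‖ ≤ B → ∀ h, 0 < h → h ≤ h₀ →
      |discreteLaplacian (fun z => F (‖z‖ ^ 2)) z h
        - h ^ 2 * (c * (2 * n + 4 * q) * (‖z‖ ^ 2) ^ q)| ≤ C * h ^ 3 := by
  set a : ℝ := δ ^ 2 with ha_def
  have ha : 0 < a := by positivity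
  rcases lt_or_ge B 0 with hB | hB
  · exact ⟨0, 1, one_pos, fun z _ hz => absurd ((norm_nonneg z).trans hz) (not_le.2 hB)⟩
  set F₂ : ℝ → ℝ := fun t => c * (q * t ^ (q - 1)) with hF₂
  set F₃ : ℝ → ℝ := fun t => c * (q * ((q - 1) * t ^ (q - 1 - 1))) with hF₃
  have h₂ : ∀ t, 0 < t → HasDerivAt (fun t => c * t ^ q) (F₂ t) t := fun t ht =>
    (Real.hasDerivAt_rpow_const (Or.inl ht.ne')).const_mul c
  have h₃ : ∀ t, 0 < t → HasDerivAt F₂ (F₃ t) t := fun t ht =>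
    ((Real.hasDerivAt_rpow_const (Or.inl ht.ne')).const_mul q).const_mul c
  set C₂ : ℝ := |c| * (|q| * (a / 2) ^ (q - 1)) with hC₂
  set C₃ : ℝ := |c| * (|q| * (|q - 1| * (a / 2) ^ (q - 1 - 1))) with hC₃
  have hpow : ∀ t p : ℝ, a / 2 ≤ t → p ≤ 0 → |t ^ p| ≤ (a / 2) ^ p := fun t p ht hp => by
    have h0 : 0 < a / 2 := by positivity
    rw [abs_of_nonneg (Real.rpow_nonneg (h0.le.trans ht) p)]
    exact Real.rpow_le_rpow_of_nonpos h0 ht hp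
  have b₂ : ∀ t, a / 2 ≤ t → |F₂ t| ≤ C₂ := fun t ht => by
    simp only [hF₂, abs_mul, hC₂]
    gcongr
    exact hpow t _ ht (by linarith)
  have b₃ : ∀ t, a / 2 ≤ t → |F₃ t| ≤ C₃ := fun t ht => by
    simp only [hF₃, abs_mul, hC₃]
    gcongr
    exact hpow t _ ht (by linarith)
  have hC₂0 : 0 ≤ C₂ := by positivity
  have hC₃0 : 0 ≤ C₃ := by positivity
  -- Each coordinate contributes two cubic Taylor remainders and a term `F₂ t * h ^ 4`. The choice
  -- of `h₀` gives `h ≤ 1` and keeps the increments of `‖z‖ ^ 2`, at most `h * (2 * B + 1)`, within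
  -- `a / 2`.
  refine ⟨n * (2 * (C₃ * (2 * B + 1) ^ 3) + C₂), min 1 (a / 2 / (2 * B + 1)),
    lt_min one_pos (by positivity), fun z hz hzB h hh hh₀ => ?_⟩
  have hh1 : h ≤ 1 := hh₀.trans (min_le_left _ _)
  have hh2 : h * (2 * B + 1) ≤ a / 2 := by
    rw [← le_div_iff₀ (by positivity)]; exact hh₀.trans (min_le_right _ _)
  set t : ℝ := ‖z‖ ^ 2 with ht_def
  have hta : a ≤ t := by rw [ha_def, ht_def]; gcongr
  have ht : 0 < t := ha.trans_le hta
  have hsum : t = ∑ i, z i ^ 2 := EuclideanSpace.real_norm_sq_eq z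
  have hcoord : ∀ i, |z i| ≤ B := fun i => (by simpa using PiLp.norm_apply_le z i : |z i| ≤ ‖z‖).trans hzB
  have hinner : ∀ i, inner ℝ z (h • EuclideanSpace.single i (1 : ℝ)) = h * z i := fun i => by
    simp [inner_smul_right, EuclideanSpace.inner_single_right]
  have hnorm : ∀ i : Fin n, ‖h • EuclideanSpace.single i (1 : ℝ)‖ ^ 2 = h ^ 2 := fun i => by
    simp [norm_smul]
  have hplus : ∀ i, ‖z + h • EuclideanSpace.single i (1 : ℝ)‖ ^ 2 = t + (2 * h * z i + h ^ 2) := by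
    intro i
    rw [norm_add_sq_real, hinner, hnorm]; ring
  have hminus : ∀ i, ‖z - h • EuclideanSpace.single i (1 : ℝ)‖ ^ 2
      = t + (-(2 * h * z i) + h ^ 2) := by
    intro i
    rw [norm_sub_sq_real, hinner, hnorm]; ring
  have hsmall : ∀ w : ℝ, |w| ≤ B → |2 * h * w + h ^ 2| ≤ h * (2 * B + 1) := by
    intro w hw
    obtain ⟨w₁, w₂⟩ := abs_le.1 hw
    rw [abs_le]
    constructor <;> nlinarith
  have rem : ∀ w : ℝ, |w| ≤ B →
      |F (t + (2 * h * w + h ^ 2)) - F t - c * t ^ q * (2 * h * w + h ^ 2)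
        - F₂ t * (2 * h * w + h ^ 2) ^ 2 / 2| ≤ C₃ * (2 * B + 1) ^ 3 * h ^ 3 := by
    intro w hw
    refine (abs_taylor_two_le ha hF h₂ h₃ b₃ hta ((hsmall w hw).trans hh2)).trans ?_
    calc C₃ * |2 * h * w + h ^ 2| ^ 3 ≤ C₃ * (h * (2 * B + 1)) ^ 3 := by
          gcongr; exact hsmall w hw
      _ = _ := by ring
  -- This is `Δ F(‖z‖²) = 2n F' + 4t F''` at `t = ‖z‖²`.
  have hmain : c * (2 * n + 4 * q) * t ^ q = ∑ i, (2 * (c * t ^ q) + 4 * z i ^ 2 * F₂ t) := by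
    rw [Finset.sum_add_distrib, ← Finset.sum_mul _ _ (F₂ t),
      ← Finset.mul_sum _ (fun i => z i ^ 2) 4, ← hsum, hF₂]
    have : t * t ^ (q - 1) = t ^ q := by
      rw [Real.rpow_sub_one ht.ne']; field_simp
    simp only [Finset.sum_const, Finset.card_univ, Fintype.card_fin, nsmul_eq_mul]
    linear_combination (-4 * c * q) * this
  rw [discreteLaplacian, hmain, Finset.mul_sum, ← Finset.sum_sub_distrib]
  refine (Finset.abs_sum_le_sum_abs _ _).trans ?_
  have hle : ∀ i ∈ (Finset.univ : Finset (Fin n)),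
      |F (‖z + h • EuclideanSpace.single i (1 : ℝ)‖ ^ 2)
        + F (‖z - h • EuclideanSpace.single i (1 : ℝ)‖ ^ 2) - 2 * F t
        - h ^ 2 * (2 * (c * t ^ q) + 4 * z i ^ 2 * F₂ t)|
      ≤ (2 * (C₃ * (2 * B + 1) ^ 3) + C₂) * h ^ 3 := by
    intro i _
    rw [hplus, hminus]
    have r₁ := abs_le.1 (rem (z i) (hcoord i))
    have r₂ := abs_le.1 (rem (-z i) (by rw [abs_neg]; exact hcoord i))
    have r₃ : |F₂ t * h ^ 4| ≤ C₂ * h ^ 3 := by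
      rw [abs_mul, abs_of_pos (by positivity : (0 : ℝ) < h ^ 4)]
      have : h ^ 4 ≤ h ^ 3 := pow_le_pow_of_le_one hh.le hh1 (by norm_num)
      gcongr
      exact b₂ t (by linarith)
    have r₄ := abs_le.1 r₃
    have e : 2 * h * -z i = -(2 * h * z i) := by ring
    rw [e] at r₂
    rw [abs_le]
    constructor <;> nlinarith
  refine (Finset.sum_le_sum hle).trans ?_
  simp [mul_assoc]

theorem HasLimitLaplacian.of_abs_sub_le {C h₀ : ℝ} (h₀pos : 0 < h₀)
    (h : ∀ h, 0 < h → h ≤ h₀ → |discreteLaplacian u x h - h ^ 2 * L| ≤ C * h ^ 3) :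
    HasLimitLaplacian u x L := by
  have hlim : Tendsto (fun h : ℝ => C * h) (𝓝[>] 0) (𝓝 0) := by
    have : Continuous fun h : ℝ => C * h := by fun_prop
    simpa using (this.tendsto 0).mono_left nhdsWithin_le_nhds
  rw [HasLimitLaplacian, tendsto_iff_dist_tendsto_zero]
  refine squeeze_zero' (Eventually.of_forall fun _ => dist_nonneg) ?_ hlim
  filter_upwards [Ioc_mem_nhdsGT h₀pos] with s hs
  have hs0 : 0 < s := hs.1
  have e : discreteLaplacian u x s / s ^ 2 - L = (discreteLaplacian u x s - s ^ 2 * L) / s ^ 2 := by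
    field_simp
  rw [Real.dist_eq, e, abs_div, abs_of_pos (by positivity : 0 < s ^ 2),
    div_le_iff₀ (by positivity)]
  refine (h s hs.1 hs.2).trans_eq (by ring)

end Laplacian

/-! ### The strictly subharmonic barrier -/

section Barrier

/-- The radial power `‖x‖ ^ (3 / 2 - n)`, strictly subharmonic away from the origin. -/
noncomputable def powerBarrier (n : ℕ) (x : EuclideanSpace ℝ (Fin n)) : ℝ :=
  (‖x‖ ^ 2) ^ (3 / 4 - n / 2 : ℝ)

variable {n : ℕ} {x y : EuclideanSpace ℝ (Fin n)}

theorem powerBarrier_eq (x : EuclideanSpace ℝ (Fin n)) :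
    powerBarrier n x = ‖x‖ ^ (3 / 2 - n : ℝ) := by
  rw [powerBarrier, ← Real.rpow_natCast_mul (norm_nonneg x)]
  congr 1
  push_cast
  ring

theorem powerBarrier_pos (hx : x ≠ 0) : 0 < powerBarrier n x := by
  rw [powerBarrier_eq]
  exact Real.rpow_pos_of_pos (norm_pos_iff.2 hx) _

theorem powerBarrier_le (hn : 2 ≤ n) (hx : x ≠ 0) (hxy : ‖x‖ ≤ ‖y‖) :
    powerBarrier n y ≤ powerBarrier n x := by
  have : (2 : ℝ) ≤ n := by exact_mod_cast hn
  rw [powerBarrier_eq, powerBarrier_eq]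
  exact Real.rpow_le_rpow_of_nonpos (norm_pos_iff.2 hx) hxy (by linarith)

theorem powerBarrier_congr (hxy : ‖x‖ = ‖y‖) : powerBarrier n x = powerBarrier n y := by
  rw [powerBarrier, powerBarrier, hxy]

theorem continuousOn_powerBarrier : ContinuousOn (powerBarrier n) {0}ᶜ := by
  intro x hx
  have hx' : ‖x‖ ≠ 0 := norm_ne_zero_iff.2 hx
  have : powerBarrier n = fun x => ‖x‖ ^ (3 / 2 - n : ℝ) := funext powerBarrier_eq
  rw [this]
  exact (continuous_norm.continuousAt.rpow_const (Or.inl hx')).continuousWithinAt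

theorem tendsto_powerBarrier_cocompact (hn : 2 ≤ n) :
    Tendsto (powerBarrier n) (cocompact _) (𝓝 0) := by
  have h2 : (2 : ℝ) ≤ n := by exact_mod_cast hn
  have := (tendsto_rpow_neg_atTop (y := n - 3 / 2) (by linarith)).comp
    (tendsto_norm_cocompact_atTop (E := EuclideanSpace ℝ (Fin n)))
  refine this.congr fun x => ?_
  rw [powerBarrier_eq, Function.comp_apply, neg_sub]

theorem exists_hasLimitLaplacian_powerBarrier (hn : 2 ≤ n) (hx : x ≠ 0) :
    ∃ L > 0, HasLimitLaplacian (powerBarrier n) x L := by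
  have h2 : (2 : ℝ) ≤ n := by exact_mod_cast hn
  have hx' : 0 < ‖x‖ := norm_pos_iff.2 hx
  set p : ℝ := 3 / 4 - n / 2 with hp
  obtain ⟨C, h₀, h₀pos, hC⟩ := exists_abs_discreteLaplacian_radial_sub_le (n := n)
    (F := fun t => t ^ p) (c := p) (q := p - 1) (by linarith)
    (fun t ht => Real.hasDerivAt_rpow_const (Or.inl ht.ne')) hx' ‖x‖
  refine ⟨p * (2 * n + 4 * (p - 1)) * (‖x‖ ^ 2) ^ (p - 1), ?_,
    HasLimitLaplacian.of_abs_sub_le h₀pos fun h hh hh₀ => hC x le_rfl le_rfl h hh hh₀⟩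
  -- Here `2 * n + 4 * (p - 1) = -1` and `p < 0`, so the coefficient is positive.
  have : 0 < (‖x‖ ^ 2) ^ (p - 1) := Real.rpow_pos_of_pos (by positivity) _
  refine mul_pos (mul_pos_of_neg_of_neg ?_ ?_) this <;> linarith

end Barrier

/-! ### Strong maximum principle and comparison at infinity -/

section MaximumPrinciple

variable {n : ℕ} {u : EuclideanSpace ℝ (Fin n) → ℝ}

/-- A harmonic function plus a positive multiple of a translated power barrier has no local
maximum. -/
theorem not_isLocalMax_add_powerBarrier (hn : 2 ≤ n) {x y : EuclideanSpace ℝ (Fin n)}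
    (hu : HasLimitLaplacian u x 0) (hxy : x ≠ y) {ε : ℝ} (hε : 0 < ε) (c : ℝ) :
    ¬ IsLocalMax (fun z => u z + ε * (powerBarrier n (z - y) - c)) x := by
  intro h
  obtain ⟨L, hL, hLap⟩ := exists_hasLimitLaplacian_powerBarrier hn (sub_ne_zero.2 hxy)
  have h' : IsLocalMax (fun z => u z + ε * powerBarrier n (z - y)) x := by
    filter_upwards [h] with z hz
    linarith
  have := (hu.add ((hLap.comp_sub y).const_mul ε)).nonpos_of_isLocalMax h'
  have := mul_pos hε hL
  linarith

theorem IsCompact.exists_pos_forall_le_sub {X : Type*} [TopologicalSpace X] {K : Set X}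
    (hK : IsCompact K) {f : X → ℝ} (hf : ContinuousOn f K) {M : ℝ} (h : ∀ x ∈ K, f x < M) :
    ∃ δ > 0, ∀ x ∈ K, f x ≤ M - δ := by
  rcases K.eq_empty_or_nonempty with rfl | hne
  · exact ⟨1, one_pos, by simp⟩
  · obtain ⟨p, hp, hmax⟩ := hK.exists_isMaxOn hne hf
    exact ⟨M - f p, by linarith [h p hp], fun x hx => by linarith [isMaxOn_iff.1 hmax x hx]⟩

/-- Local form of the strong maximum principle, proved with a barrier. -/
theorem eq_on_ball_of_forall_closedBall_le (hn : 2 ≤ n) (hu : Continuous u)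
    {x₁ : EuclideanSpace ℝ (Fin n)} {ρ : ℝ}
    (hharm : ∀ x ∈ Metric.closedBall x₁ ρ, HasLimitLaplacian u x 0)
    (hle : ∀ x ∈ Metric.closedBall x₁ ρ, u x ≤ u x₁) :
    ∀ y ∈ Metric.ball x₁ (ρ / 4), u y = u x₁ := by
  intro y hy
  rw [Metric.mem_ball'] at hy
  have hρ : 0 < ρ := by linarith [dist_nonneg (x := x₁) (y := y)]
  by_contra hne
  have hyM : u y < u x₁ := lt_of_le_of_ne (hle y (by
    rw [Metric.mem_closedBall']; linarith)) hne
  set T : Set (EuclideanSpace ℝ (Fin n)) := Metric.closedBall x₁ ρ ∩ {x | u x = u x₁} with hT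
  have hTc : IsCompact T :=
    (isCompact_closedBall x₁ ρ).inter_right (isClosed_eq hu continuous_const)
  have hx₁T : x₁ ∈ T := ⟨Metric.mem_closedBall_self hρ.le, rfl⟩
  -- A point of the contact set nearest to `y`: the open ball about `y` through `x₀` then contains
  -- no contact point, as in Hopf's lemma.
  obtain ⟨x₀, hx₀, hmin⟩ := hTc.exists_isMinOn ⟨x₁, hx₁T⟩
    (f := fun x => dist x y) (by fun_prop)
  rw [isMinOn_iff] at hmin
  set r := dist x₀ y with hr
  have hrlt : r < ρ / 4 := (hmin x₁ hx₁T).trans_lt hy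
  have hr0 : 0 < r := by
    refine dist_pos.2 ?_
    rintro rfl
    exact hyM.ne hx₀.2
  have hin : ∀ w, dist w y ≤ r → w ∈ Metric.closedBall x₁ ρ := fun w hw => by
    rw [Metric.mem_closedBall]
    have := dist_triangle_right w x₁ y
    linarith
  have hlt : ∀ w, dist w y < r → u w < u x₁ := fun w hw =>
    lt_of_le_of_ne (hle w (hin w hw.le)) fun h => (hmin w ⟨hin w hw.le, h⟩).not_gt hw
  obtain ⟨δ, hδ, hδle⟩ := (isCompact_sphere y (r / 2)).exists_pos_forall_le_sub
    hu.continuousOn (M := u x₁) fun w hw => hlt w (by rw [Metric.mem_sphere.1 hw]; linarith)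
  set w₁ : EuclideanSpace ℝ (Fin n) := (1 / 2 : ℝ) • (x₀ - y) with hw₁
  have hw₁n : ‖w₁‖ = r / 2 := by
    rw [hw₁, norm_smul, ← dist_eq_norm, ← hr]; norm_num; ring
  have hw₁0 : w₁ ≠ 0 := norm_ne_zero_iff.1 (by rw [hw₁n]; positivity)
  have hx₀y : x₀ - y ≠ 0 := sub_ne_zero.2 (dist_pos.1 hr0)
  set g := powerBarrier n w₁ with hg
  have hgpos : 0 < g := powerBarrier_pos hw₁0
  set c := powerBarrier n (x₀ - y) with hc
  have hcpos : 0 < c := powerBarrier_pos hx₀y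
  -- With this `ε` the barrier adds at most the gap `δ` on the inner sphere of radius `r / 2`, and
  -- subtracting `c` makes it vanish on the outer sphere of radius `r`.
  set ε := δ / g with hε
  have hεpos : 0 < ε := div_pos hδ hgpos
  set v : EuclideanSpace ℝ (Fin n) → ℝ := fun z => u z + ε * (powerBarrier n (z - y) - c) with hv
  have hnolocal : ∀ x ∈ Metric.closedBall x₁ ρ, x ≠ y → ¬ IsLocalMax v x := fun x hx hxy =>
    not_isLocalMax_add_powerBarrier hn (hharm x hx) hxy hεpos c
  set A : Set (EuclideanSpace ℝ (Fin n)) := Metric.closedBall y r ∩ {z | r / 2 ≤ dist z y} with hA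
  have hAc : IsCompact A := (isCompact_closedBall y r).inter_right
    (isClosed_le continuous_const (by fun_prop))
  have hx₀A : x₀ ∈ A := ⟨Metric.mem_closedBall.2 le_rfl, by simp only [mem_ofPred_eq]; linarith⟩
  have hvc : ContinuousOn v A := by
    refine hu.continuousOn.add (continuousOn_const.mul (ContinuousOn.sub ?_ continuousOn_const))
    refine continuousOn_powerBarrier.comp (by fun_prop) fun z hz => ?_
    have : r / 2 ≤ dist z y := hz.2
    exact sub_ne_zero.2 (dist_pos.1 (by linarith))
  have hvA : ∀ z ∈ A, v z ≤ u x₁ := by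
    obtain ⟨p, hp, hpmax⟩ := hAc.exists_isMaxOn ⟨x₀, hx₀A⟩ hvc
    rw [isMaxOn_iff] at hpmax
    refine fun z hz => (hpmax z hz).trans ?_
    have hp₁ : dist p y ≤ r := hp.1
    have hp₂ : r / 2 ≤ dist p y := hp.2
    rcases hp₁.lt_or_eq with h₁ | h₁
    · rcases hp₂.lt_or_eq with h₂ | h₂
      · refine absurd ?_ (hnolocal p (hin p hp₁) (dist_pos.1 (by linarith)))
        have hc' : ContinuousAt (fun z => dist z y) p := by fun_prop
        filter_upwards [hc'.eventually_lt_const h₁, hc'.eventually_const_lt h₂] with z hz₁ hz₂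
        exact hpmax z ⟨hz₁.le, hz₂.le⟩
      · have e : powerBarrier n (p - y) = g := powerBarrier_congr (by
          rw [hw₁n, ← dist_eq_norm, h₂])
        have : ε * g = δ := div_mul_cancel₀ δ hgpos.ne'
        have := hδle p h₂.symm
        have := mul_pos hεpos hcpos
        simp only [hv, e]
        linarith [mul_sub ε g c]
    · have e : powerBarrier n (p - y) = c := powerBarrier_congr (by
        rw [← dist_eq_norm, ← dist_eq_norm, h₁])
      simpa [hv, e] using hle p (hin p hp₁)
  -- The contradiction is a local maximum of `v` at `x₀`: on the annulus `v ≤ u x₁`, and outside the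
  -- ball the barrier term is nonpositive, so `v ≤ u ≤ u x₁`.
  refine hnolocal x₀ hx₀.1 (dist_pos.1 hr0) ?_
  have hvx₀ : v x₀ = u x₁ := by
    have : u x₀ = u x₁ := hx₀.2
    simp [hv, ← hc, this]
  filter_upwards [Metric.ball_mem_nhds x₀ (half_pos hr0)] with z hz
  rw [hvx₀]
  rw [Metric.mem_ball] at hz
  have h₁ := dist_triangle_left x₀ y z
  rcases le_or_gt (dist z y) r with h | h
  · exact hvA z ⟨h, by simp only [mem_ofPred_eq]; linarith⟩
  · have hle' : powerBarrier n (z - y) ≤ c := powerBarrier_le hn hx₀y (by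
      rw [← dist_eq_norm, ← dist_eq_norm]; exact h.le)
    have hz₁ : z ∈ Metric.closedBall x₁ ρ := by
      rw [Metric.mem_closedBall]
      have h₂ := dist_triangle z x₀ x₁
      have h₃ := dist_triangle_right x₀ x₁ y
      linarith
    have := mul_nonneg hεpos.le (sub_nonneg.2 hle')
    have := hle z hz₁
    simp only [hv]
    linarith [mul_sub ε c (powerBarrier n (z - y)), mul_sub ε (powerBarrier n (z - y)) c]

/-- Strong maximum principle. -/
theorem eqOn_of_isMaxOn_of_hasLimitLaplacian (hn : 2 ≤ n) (hu : Continuous u)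
    {Ω : Set (EuclideanSpace ℝ (Fin n))} (hΩo : IsOpen Ω) (hΩc : IsPreconnected Ω)
    (hharm : ∀ x ∈ Ω, HasLimitLaplacian u x 0) {x₁ : EuclideanSpace ℝ (Fin n)} (hx₁ : x₁ ∈ Ω)
    (hle : ∀ x ∈ Ω, u x ≤ u x₁) : ∀ x ∈ Ω, u x = u x₁ := by
  have hopen : IsOpen (Ω ∩ {x | u x = u x₁}) := by
    rw [Metric.isOpen_iff]
    rintro y ⟨hy, hyM⟩
    have hyM : u y = u x₁ := hyM
    obtain ⟨ρ, hρ, hsub⟩ := Metric.nhds_basis_closedBall.mem_iff.1 (hΩo.mem_nhds hy)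
    refine ⟨ρ / 4, by positivity, fun z hz => ⟨hsub ?_, ?_⟩⟩
    · exact Metric.ball_subset_closedBall (Metric.ball_subset_ball (by linarith) hz)
    · rw [mem_ofPred_eq, ← hyM]
      exact eq_on_ball_of_forall_closedBall_le hn hu (fun x hx => hharm x (hsub hx))
        (fun x hx => by rw [hyM]; exact hle x (hsub hx)) z hz
  -- Connectedness: `Ω` is the disjoint union of the open sets where `u = u x₁` and where `u < u
  -- x₁`.
  have hsub : Ω ⊆ Ω ∩ {x | u x = u x₁} := by
    refine hΩc.subset_left_of_subset_union hopen
      (hΩo.inter (isOpen_lt hu continuous_const)) (v := Ω ∩ {x | u x < u x₁}) ?_ ?_ ?_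
    · refine disjoint_left.2 fun x hx hx' => ?_
      exact (ne_of_lt hx'.2) hx.2
    · intro x hx
      rcases (hle x hx).lt_or_eq with h | h
      · exact Or.inr ⟨hx, h⟩
      · exact Or.inl ⟨hx, h⟩
    · exact ⟨x₁, hx₁, hx₁, rfl⟩
  exact fun x hx => (hsub hx).2

theorem tendsto_cocompact_zero_of_abs_le_rpow (hn : 2 ≤ n) {C R : ℝ}
    (hdecay : ∀ x, R ≤ ‖x‖ → |u x| ≤ C * ‖x‖ ^ (1 - n : ℝ)) :
    Tendsto u (cocompact _) (𝓝 0) := by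
  have h2 : (2 : ℝ) ≤ n := by exact_mod_cast hn
  have h₁ : Tendsto (fun x : EuclideanSpace ℝ (Fin n) => C * ‖x‖ ^ (1 - n : ℝ))
      (cocompact _) (𝓝 0) := by
    have := ((tendsto_rpow_neg_atTop (y := n - 1) (by linarith)).comp
      (tendsto_norm_cocompact_atTop (E := EuclideanSpace ℝ (Fin n)))).const_mul C
    simpa [Function.comp_def] using this
  refine squeeze_zero_norm' ?_ h₁
  filter_upwards [tendsto_norm_cocompact_atTop.eventually_ge_atTop R] with x hx
  exact hdecay x hx

/-- A harmonic function on an exterior domain that decays like `‖x‖ ^ (1 - n)` is not negative on a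
whole sphere. -/
theorem exists_mem_sphere_nonneg_of_decay (hn : 2 ≤ n) (hu : Continuous u) {R C : ℝ} (hR : 0 < R)
    (hharm : ∀ x, R < ‖x‖ → HasLimitLaplacian u x 0)
    (hdecay : ∀ x, R ≤ ‖x‖ → |u x| ≤ C * ‖x‖ ^ (1 - n : ℝ)) :
    ∃ x, ‖x‖ = R ∧ 0 ≤ u x := by
  by_contra! hneg
  obtain ⟨δ, hδ, hδle⟩ := (isCompact_sphere (0 : EuclideanSpace ℝ (Fin n)) R).exists_pos_forall_le_sub
    hu.continuousOn (M := 0) fun w hw => hneg w (by simpa using hw)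
  have hsingle : ∀ r, 0 < r →
      ∃ w : EuclideanSpace ℝ (Fin n), ‖w‖ = r := fun r hr =>
    ⟨EuclideanSpace.single ⟨0, by omega⟩ r, by simp [abs_of_pos hr]⟩
  obtain ⟨w, hw⟩ := hsingle R hR
  have hne : ∀ z : EuclideanSpace ℝ (Fin n), R ≤ ‖z‖ → z ≠ 0 := fun z hz =>
    norm_ne_zero_iff.1 (by linarith)
  have hgpos : 0 < powerBarrier n w := powerBarrier_pos (hne w hw.ge)
  set ε := δ / powerBarrier n w with hε
  have hεpos : 0 < ε := div_pos hδ hgpos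
  set v : EuclideanSpace ℝ (Fin n) → ℝ := fun z => u z + ε * (powerBarrier n (z - 0) - 0) with hv
  have hvlim : Tendsto v (cocompact _) (𝓝 0) := by
    simpa [hv] using (tendsto_cocompact_zero_of_abs_le_rpow hn hdecay).add
      ((tendsto_powerBarrier_cocompact hn).const_mul ε)
  -- A positive value would force a maximum at finite distance, since `v → 0`. It cannot lie in the
  -- exterior, where `v` has no local maximum, nor on the sphere, where `u ≤ -δ` and the barrier
  -- term is `δ`.
  have hvle : ∀ x, R ≤ ‖x‖ → v x ≤ 0 := by
    intro x hx
    by_contra! hpos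
    obtain ⟨K, hK, hKsub⟩ := mem_cocompact.1 (hvlim.eventually_lt_const hpos)
    obtain ⟨R₁, hR₁⟩ := hK.isBounded.subset_closedBall (0 : EuclideanSpace ℝ (Fin n))
    have hout : ∀ z : EuclideanSpace ℝ (Fin n), R₁ < ‖z‖ → v z < v x := fun z hz =>
      hKsub fun hzK => by
        have := hR₁ hzK
        rw [mem_closedBall_zero_iff] at this
        linarith
    set A : Set (EuclideanSpace ℝ (Fin n)) :=
      Metric.closedBall 0 R₁ ∩ {z | R ≤ ‖z‖} with hA
    have hAc : IsCompact A := (isCompact_closedBall _ _).inter_right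
      (isClosed_le continuous_const (by fun_prop))
    have hxA : x ∈ A := by
      refine ⟨?_, hx⟩
      rw [mem_closedBall_zero_iff]
      by_contra! h
      exact lt_irrefl _ (hout x h)
    have hvc : ContinuousOn v A := by
      refine hu.continuousOn.add (continuousOn_const.mul (ContinuousOn.sub ?_ continuousOn_const))
      refine continuousOn_powerBarrier.comp (by fun_prop) fun z hz => ?_
      simpa using hne z hz.2
    obtain ⟨p, hp, hpmax⟩ := hAc.exists_isMaxOn ⟨x, hxA⟩ hvc
    rw [isMaxOn_iff] at hpmax
    have hpx : v x ≤ v p := hpmax x hxA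
    have hpR : R ≤ ‖p‖ := hp.2
    rcases hpR.lt_or_eq with h | h
    · refine not_isLocalMax_add_powerBarrier hn (hharm p h) (hne p hpR) hεpos 0 ?_
      have hc' : ContinuousAt (fun z : EuclideanSpace ℝ (Fin n) => ‖z‖) p := by fun_prop
      filter_upwards [hc'.eventually_const_lt h] with z hz
      rcases le_or_gt ‖z‖ R₁ with hz₁ | hz₁
      · exact hpmax z ⟨mem_closedBall_zero_iff.2 hz₁, hz.le⟩
      · exact (hout z hz₁).le.trans hpx
    · have e : powerBarrier n p = powerBarrier n w := powerBarrier_congr (by rw [hw, h])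
      have e' : ε * powerBarrier n w = δ := div_mul_cancel₀ δ hgpos.ne'
      have := hδle p (by simpa using h.symm)
      have : v p ≤ 0 := by
        simp only [hv, sub_zero, e, e']
        linarith
      linarith
  -- At radius `s` the two bounds give `ε * √s ≤ C`, while this `s` makes `ε * √s ≥ C + 1`.
  set s := max R (((C + 1) / ε) ^ 2) with hs
  have hs0 : 0 < s := hR.trans_le (le_max_left _ _)
  obtain ⟨z, hz⟩ := hsingle s hs0
  have h₁ := hvle z (by rw [hz]; exact le_max_left _ _)
  have h₂ := (abs_le.1 (hdecay z (by rw [hz]; exact le_max_left _ _))).1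
  simp only [hv, sub_zero, powerBarrier_eq, hz] at h₁
  rw [hz] at h₂
  have h₃ : ε * s ^ (3 / 2 - n : ℝ) ≤ C * s ^ (1 - n : ℝ) := by linarith
  have h₄ : s ^ (3 / 2 - n : ℝ) = √s * s ^ (1 - n : ℝ) := by
    rw [Real.sqrt_eq_rpow, ← Real.rpow_add hs0]
    congr 1
    ring
  rw [h₄, ← mul_assoc] at h₃
  have h₅ := le_of_mul_le_mul_right h₃ (Real.rpow_pos_of_pos hs0 _)
  have h₆ : (C + 1) / ε ≤ √s :=
    Real.le_sqrt_of_sq_le (le_max_right _ _)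
  rw [div_le_iff₀ hεpos] at h₆
  linarith

end MaximumPrinciple

/-! ### The Newtonian kernel: profile, Lipschitz bound, local integrability -/

section Kernel

variable {n : ℕ}

/-- Written in `‖z‖ ^ 2`, the logarithmic and power cases have the same form of derivative and need
no further distinction. The exponent `q = -n / 2` is the one for which `2 * n + 4 * q = 0`, which is
harmonicity. -/
theorem exists_newtonianKernel_profile (n : ℕ) :
    ∃ (F : ℝ → ℝ) (c : ℝ), (newtonianKernel n = fun z => F (‖z‖ ^ 2)) ∧
      ∀ t, 0 < t → HasDerivAt F (c * t ^ (-(n / 2) : ℝ)) t := by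
  by_cases h : n = 2
  · subst h
    refine ⟨fun t => 1 / (4 * Real.pi) * Real.log t, 1 / (4 * Real.pi), ?_, fun t ht => ?_⟩
    · funext z
      simp only [newtonianKernel, if_true, Real.log_pow]
      push_cast
      field_simp
      ring
    · refine ((Real.hasDerivAt_log ht.ne').const_mul _).congr_deriv ?_
      rw [show (-(((2 : ℕ) : ℝ) / 2)) = -1 by norm_num, Real.rpow_neg_one]
  · set A : ℝ := 1 / ((n : ℝ) * (2 - (n : ℝ)) * unitBallVolume n) with hA
    refine ⟨fun t => A * t ^ (1 - n / 2 : ℝ), A * (1 - n / 2), ?_, fun t ht => ?_⟩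
    · funext z
      simp only [newtonianKernel, if_neg h]
      rw [← Real.rpow_natCast_mul (norm_nonneg z)]
      congr 2
      push_cast
      ring
    · refine ((Real.hasDerivAt_rpow_const (Or.inl ht.ne')).const_mul A).congr_deriv ?_
      rw [show (1 - n / 2 - 1 : ℝ) = -(n / 2) by ring]
      ring

theorem measurable_newtonianKernel : Measurable (newtonianKernel n) := by
  unfold newtonianKernel
  split_ifs <;> fun_prop

/-- Lipschitz bound for the Newtonian kernel away from the origin. -/
theorem exists_abs_newtonianKernel_sub_le (hn : 1 ≤ n) :
    ∃ C, 0 ≤ C ∧ ∀ a, 0 < a → ∀ z w : EuclideanSpace ℝ (Fin n), a ≤ ‖z‖ → a ≤ ‖w‖ →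
      |newtonianKernel n z - newtonianKernel n w| ≤ C * a ^ (1 - n : ℝ) * |‖z‖ - ‖w‖| := by
  obtain ⟨F, c, hN, hF⟩ := exists_newtonianKernel_profile n
  have h1 : (1 : ℝ) ≤ n := by exact_mod_cast hn
  refine ⟨2 * |c|, by positivity, fun a ha z w hz hw => ?_⟩
  have hd : ∀ r : ℝ, 0 < r → HasDerivAt (fun r => F (r ^ 2)) (2 * c * r ^ (1 - n : ℝ)) r := by
    intro r hr
    refine ((hF (r ^ 2) (by positivity)).comp r (hasDerivAt_pow 2 r)).congr_deriv ?_
    rw [← Real.rpow_natCast_mul hr.le, show ((2 : ℕ) : ℝ) * -(n / 2 : ℝ) = (1 - n) - 1 by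
      push_cast; ring, Real.rpow_sub_one hr.ne']
    field_simp
    norm_num
    ring
  have := (convex_Ici a).norm_image_sub_le_of_norm_hasDerivWithin_le
    (f := fun r => F (r ^ 2)) (f' := fun r => 2 * c * r ^ (1 - n : ℝ))
    (C := 2 * |c| * a ^ (1 - n : ℝ))
    (fun r hr => (hd r (ha.trans_le hr)).hasDerivWithinAt)
    (fun r hr => by
      rw [Real.norm_eq_abs, abs_mul, abs_mul, abs_two,
        abs_of_nonneg (Real.rpow_nonneg (ha.le.trans hr) _)]
      exact mul_le_mul_of_nonneg_left
        (Real.rpow_le_rpow_of_nonpos ha hr (by linarith)) (by positivity))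
    (x := ‖w‖) (y := ‖z‖) hw hz
  simpa [hN] using this

/-- Comparison with a reference point of norm `R` through the Lipschitz bound. The exponent `1 - n`
is not sharp, but it covers the logarithm too and is still integrable at the origin. -/
theorem exists_abs_newtonianKernel_le (hn : 1 ≤ n) {R : ℝ} (hR : 0 < R) :
    ∃ C, ∀ z : EuclideanSpace ℝ (Fin n), z ≠ 0 → ‖z‖ ≤ R →
      |newtonianKernel n z| ≤ C * ‖z‖ ^ (1 - n : ℝ) := by
  obtain ⟨C, hC, hlip⟩ := exists_abs_newtonianKernel_sub_le hn
  have h1 : (1 : ℝ) ≤ n := by exact_mod_cast hn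
  set w : EuclideanSpace ℝ (Fin n) := EuclideanSpace.single ⟨0, by omega⟩ R with hw
  have hwn : ‖w‖ = R := by simp [hw, abs_of_pos hR]
  set D := |newtonianKernel n w| / R ^ (1 - n : ℝ) with hD
  have hRp : 0 < R ^ (1 - n : ℝ) := Real.rpow_pos_of_pos hR _
  refine ⟨D + C * R, fun z hz hzR => ?_⟩
  have hz0 : 0 < ‖z‖ := norm_pos_iff.2 hz
  have h₁ := hlip ‖z‖ hz0 z w le_rfl (by rw [hwn]; exact hzR)
  have h₂ : |newtonianKernel n w| ≤ D * ‖z‖ ^ (1 - n : ℝ) := by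
    calc |newtonianKernel n w| = D * R ^ (1 - n : ℝ) := by rw [hD, div_mul_cancel₀ _ hRp.ne']
      _ ≤ D * ‖z‖ ^ (1 - n : ℝ) := by
        have := Real.rpow_le_rpow_of_nonpos hz0 hzR (by linarith : (1 - n : ℝ) ≤ 0)
        gcongr
  have h₃ : |‖z‖ - ‖w‖| ≤ R := by
    rw [hwn, abs_le]; constructor <;> linarith
  have h₄ : C * ‖z‖ ^ (1 - n : ℝ) * |‖z‖ - ‖w‖| ≤ C * ‖z‖ ^ (1 - n : ℝ) * R := by gcongr
  have h₅ := abs_sub_abs_le_abs_sub (newtonianKernel n z) (newtonianKernel n w)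
  linarith

theorem integrableOn_ball_newtonianKernel (hn : 1 ≤ n) {R : ℝ} (hR : 0 < R) :
    IntegrableOn (newtonianKernel n) (Metric.ball 0 R) := by
  obtain ⟨C, hC⟩ := exists_abs_newtonianKernel_le hn hR
  have : Nontrivial (EuclideanSpace ℝ (Fin n)) :=
    Module.nontrivial_of_finrank_pos (R := ℝ) (by rw [finrank_euclideanSpace_fin]; omega)
  refine integrableOn_ball_of_norm_le_rpow (C := C) (α := n - 1) (by simpa using hn) (by simp) ?_
    measurable_newtonianKernel.aestronglyMeasurable
  have h0 : ∀ᵐ z : EuclideanSpace ℝ (Fin n), z ≠ 0 := by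
    simp [ae_iff]
  filter_upwards [ae_restrict_mem Metric.isOpen_ball.measurableSet, ae_restrict_of_ae h0]
    with z hz hz0
  rw [neg_sub]
  exact hC z hz0 (by simpa using (mem_ball_zero_iff.1 hz).le)

end Kernel

/-! ### Continuity of convolutions -/

section Convolution

variable {G : Type*} [NormedAddCommGroup G] [NormedSpace ℝ G] [FiniteDimensional ℝ G]
  [MeasurableSpace G] [BorelSpace G] {μ : Measure G} [μ.IsAddHaarMeasure] {f k : G → ℝ} {W : ℝ}

theorem integrable_mul_comp_sub_left (hf : AEStronglyMeasurable f μ) (hW : ∀ᵐ y ∂μ, |f y| ≤ W)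
    (hk : Integrable k μ) (x : G) : Integrable (fun y => f y * k (x - y)) μ :=
  (hk.comp_sub_left x).bdd_mul hf hW

/-- The convolution of a bounded function with an integrable function is continuous. -/
theorem continuous_integral_mul_comp_sub_left (hf : Integrable f μ) (hW : ∀ᵐ y ∂μ, |f y| ≤ W)
    (hk : Integrable k μ) : Continuous fun x => ∫ y, f y * k (x - y) ∂μ := by
  refine continuous_of_uniform_approx_of_continuous fun U hU => ?_
  obtain ⟨ε, hε, hεU⟩ := Metric.mem_uniformity_dist.1 hU
  -- Replacing `k` by a continuous compactly supported `g` changes the convolution uniformly by at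
  -- most `|W|` times the `L¹` error.
  obtain ⟨g, hgc, hgk, hg, hgi⟩ := hk.exists_hasCompactSupport_integral_sub_le
    (ε := ε / (2 * (|W| + 1))) (by positivity)
  refine ⟨fun x => ∫ y, f y * g (x - y) ∂μ, ?_, fun x => hεU ?_⟩
  · have := hgc.continuous_convolution_right (μ := μ)
      (ContinuousLinearMap.lsmul ℝ ℝ : ℝ →L[ℝ] ℝ →L[ℝ] ℝ)
      hf.locallyIntegrable hg
    simpa [convolution, Function.comp_def] using! this
  · rw [Real.dist_eq, ← integral_sub
      (integrable_mul_comp_sub_left hf.aestronglyMeasurable hW hk x)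
      (integrable_mul_comp_sub_left hf.aestronglyMeasurable hW hgi x)]
    have hbound : ‖∫ y, f y * k (x - y) - f y * g (x - y) ∂μ‖
        ≤ ∫ y, |W| * ‖k (x - y) - g (x - y)‖ ∂μ := by
      refine norm_integral_le_of_norm_le (((hk.sub hgi).comp_sub_left x).norm.const_mul _) ?_
      filter_upwards [hW] with y hy
      rw [← mul_sub, norm_mul]
      exact mul_le_mul_of_nonneg_right (hy.trans (le_abs_self W)) (norm_nonneg _)
    refine hbound.trans_lt ?_
    rw [integral_const_mul, integral_sub_left_eq_self (fun z => ‖k z - g z‖) μ x]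
    calc |W| * ∫ z, ‖k z - g z‖ ∂μ ≤ |W| * (ε / (2 * (|W| + 1))) := by gcongr
      _ < ε := by
        rw [← mul_div_assoc, div_lt_iff₀ (by positivity)]
        nlinarith [abs_nonneg W]

end Convolution

/-! ### The potential: continuity, harmonicity, decay -/

section Potential

variable {n : ℕ} {ω : EuclideanSpace ℝ (Fin n) → ℝ} {K : Set (EuclideanSpace ℝ (Fin n))} {W R : ℝ}

theorem newtonianPotential_apply (ω : EuclideanSpace ℝ (Fin n) → ℝ)
    (x : EuclideanSpace ℝ (Fin n)) :
    newtonianPotential ω x = ∫ y, ω y * newtonianKernel n (x - y) := by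
  simp [newtonianPotential, convolution_def]

/-- The kernel is only locally integrable. For `x` in a bounded region only its values on a fixed
ball matter, so a truncated, integrable kernel can replace it. -/
theorem mul_newtonianKernel_ae_eq (hR : K ⊆ Metric.closedBall 0 R)
    (hK : ∀ᵐ y, y ∉ K → ω y = 0) {r : ℝ} {x : EuclideanSpace ℝ (Fin n)} (hx : ‖x‖ < r) :
    (fun y => ω y * newtonianKernel n (x - y)) =ᵐ[volume]
      fun y => ω y * (Metric.ball 0 (r + R)).indicator (newtonianKernel n) (x - y) := by
  filter_upwards [hK] with y hy
  by_cases hyK : y ∈ K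
  · rw [indicator_of_mem]
    rw [mem_ball_zero_iff]
    have := mem_closedBall_zero_iff.1 (hR hyK)
    linarith [norm_sub_le x y]
  · simp [hy hyK]

theorem integrable_mul_newtonianKernel (hn : 1 ≤ n) (hω : Integrable ω) (hW : ∀ᵐ y, |ω y| ≤ W)
    (hR0 : 0 < R) (hR : K ⊆ Metric.closedBall 0 R) (hK : ∀ᵐ y, y ∉ K → ω y = 0)
    (x : EuclideanSpace ℝ (Fin n)) :
    Integrable fun y => ω y * newtonianKernel n (x - y) := by
  rw [integrable_congr (mul_newtonianKernel_ae_eq hR hK (lt_add_one ‖x‖))]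
  exact integrable_mul_comp_sub_left hω.aestronglyMeasurable hW
    ((integrable_indicator_iff measurableSet_ball).2
      (integrableOn_ball_newtonianKernel hn (by positivity))) x

theorem continuous_newtonianPotential (hn : 1 ≤ n) (hω : Integrable ω) (hW : ∀ᵐ y, |ω y| ≤ W)
    (hR0 : 0 < R) (hR : K ⊆ Metric.closedBall 0 R) (hK : ∀ᵐ y, y ∉ K → ω y = 0) :
    Continuous (newtonianPotential ω) := by
  refine continuous_iff_continuousAt.2 fun x₀ => ?_
  have h := (continuous_integral_mul_comp_sub_left hω hW
    ((integrable_indicator_iff measurableSet_ball).2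
      (integrableOn_ball_newtonianKernel hn
        (R := ‖x₀‖ + 1 + R) (by positivity)))).continuousAt (x := x₀)
  refine h.congr ?_
  have hc : ContinuousAt (fun x : EuclideanSpace ℝ (Fin n) => ‖x‖) x₀ := by fun_prop
  filter_upwards [hc.eventually_lt_const (lt_add_one ‖x₀‖)] with x hx
  rw [newtonianPotential_apply, integral_congr_ae (mul_newtonianKernel_ae_eq hR hK hx)]

/-- The Newtonian potential is harmonic off the support of the density. -/
theorem hasLimitLaplacian_newtonianPotential (hn : 1 ≤ n) (hω : Integrable ω)
    (hW : ∀ᵐ y, |ω y| ≤ W) (hR0 : 0 < R) (hR : K ⊆ Metric.closedBall 0 R) (hKc : IsClosed K)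
    (hK : ∀ᵐ y, y ∉ K → ω y = 0) {x : EuclideanSpace ℝ (Fin n)} (hx : x ∉ K) :
    HasLimitLaplacian (newtonianPotential ω) x 0 := by
  obtain ⟨δ, hδ, hδK⟩ := Metric.isOpen_iff.1 hKc.isOpen_compl x hx
  obtain ⟨F, c, hN, hF⟩ := exists_newtonianKernel_profile n
  -- For `y ∈ K` one has `δ ≤ ‖x - y‖ ≤ ‖x‖ + R`, so one `C` and one `h₀` serve the whole integral.
  obtain ⟨C, h₀, h₀pos, hC⟩ := exists_abs_discreteLaplacian_radial_sub_le (n := n)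
    (q := -(n / 2 : ℝ)) (neg_nonpos.2 (by positivity)) hF hδ (‖x‖ + R)
  rw [← hN] at hC
  have hint := integrable_mul_newtonianKernel hn hω hW hR0 hR hK
  refine HasLimitLaplacian.of_abs_sub_le (C := (∫ y, ‖ω y‖) * C) h₀pos fun h hh hh₀ => ?_
  have hD : discreteLaplacian (newtonianPotential ω) x h
      = ∫ y, ω y * discreteLaplacian (newtonianKernel n) (x - y) h := by
    simp only [discreteLaplacian, newtonianPotential_apply, Finset.mul_sum]
    rw [integral_finsetSum]
    · refine Finset.sum_congr rfl fun i _ => ?_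
      rw [← integral_const_mul, ← integral_add (hint _) (hint _),
        ← integral_sub (f := fun y => _ + _)
          ((hint _).add (hint _)) ((hint _).const_mul 2)]
      refine integral_congr_ae (Eventually.of_forall fun y => ?_)
      simp only [add_sub_right_comm x _ y, sub_right_comm x _ y]
      ring
    · intro i _
      refine (((hint (x + h • EuclideanSpace.single i 1)).add
        (hint (x - h • EuclideanSpace.single i 1))).sub ((hint x).const_mul 2)).congr
        (Eventually.of_forall fun y => ?_)
      simp only [Pi.add_apply, Pi.sub_apply, add_sub_right_comm x _ y, sub_right_comm x _ y]
      ring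
  rw [mul_zero, sub_zero, hD, mul_assoc, ← integral_mul_const, ← Real.norm_eq_abs]
  refine norm_integral_le_of_norm_le (hω.norm.mul_const _) ?_
  filter_upwards [hK] with y hy
  by_cases hyK : y ∈ K
  · rw [norm_mul]
    refine mul_le_mul_of_nonneg_left ?_ (norm_nonneg _)
    have h₁ : δ ≤ ‖x - y‖ := by
      rw [← dist_eq_norm]
      by_contra! hlt
      exact hδK (Metric.mem_ball'.2 hlt) hyK
    have h₂ := mem_closedBall_zero_iff.1 (hR hyK)
    have := hC (x - y) h₁ ((norm_sub_le x y).trans (by linarith)) h hh hh₀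
    rwa [show c * (2 * n + 4 * -(n / 2 : ℝ)) = 0 by ring, zero_mul, mul_zero, sub_zero] at this
  · simp [hy hyK]

/-- Decay of the Newtonian potential of a density with zero mean. -/
theorem exists_abs_newtonianPotential_le (hn : 1 ≤ n) (hω : Integrable ω)
    (hW : ∀ᵐ y, |ω y| ≤ W) (hR0 : 0 < R) (hR : K ⊆ Metric.closedBall 0 R)
    (hK : ∀ᵐ y, y ∉ K → ω y = 0) (hmean : ∫ y, ω y = 0) :
    ∃ C, ∀ x, 2 * R ≤ ‖x‖ → |newtonianPotential ω x| ≤ C * ‖x‖ ^ (1 - n : ℝ) := by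
  obtain ⟨C, hC, hlip⟩ := exists_abs_newtonianKernel_sub_le hn
  refine ⟨(∫ y, ‖ω y‖) * (C * (1 / 2) ^ (1 - n : ℝ) * R), fun x hx => ?_⟩
  have hx0 : 0 < ‖x‖ := by linarith
  -- The zero mean allows subtracting the constant `newtonianKernel n x`, leaving a difference
  -- controlled by the Lipschitz bound.
  have heq : newtonianPotential ω x
      = ∫ y, ω y * (newtonianKernel n (x - y) - newtonianKernel n x) := by
    simp only [mul_sub]
    rw [integral_sub (integrable_mul_newtonianKernel hn hω hW hR0 hR hK x) (hω.mul_const _),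
      integral_mul_const, hmean, zero_mul, sub_zero, newtonianPotential_apply]
  rw [heq, mul_assoc, ← integral_mul_const, ← Real.norm_eq_abs]
  refine norm_integral_le_of_norm_le (hω.norm.mul_const _) ?_
  filter_upwards [hK] with y hy
  by_cases hyK : y ∈ K
  · rw [norm_mul]
    refine mul_le_mul_of_nonneg_left ?_ (norm_nonneg _)
    have h₂ := mem_closedBall_zero_iff.1 (hR hyK)
    have h₃ := norm_sub_norm_le x y
    -- Since `‖y‖ ≤ R ≤ ‖x‖ / 2`, both points have norm at least `‖x‖ / 2`.
    have h₄ := hlip (1 / 2 * ‖x‖) (by positivity) (x - y) x (by linarith) (by linarith)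
    have h₅ : |‖x - y‖ - ‖x‖| ≤ R := by
      have := abs_norm_sub_norm_le (x - y) x
      rw [sub_sub_cancel_left, norm_neg] at this
      linarith
    refine h₄.trans ?_
    rw [Real.mul_rpow (by norm_num) hx0.le]
    calc C * ((1 / 2) ^ (1 - n : ℝ) * ‖x‖ ^ (1 - n : ℝ)) * |‖x - y‖ - ‖x‖|
        ≤ C * ((1 / 2) ^ (1 - n : ℝ) * ‖x‖ ^ (1 - n : ℝ)) * R := by gcongr
      _ = _ := by ring
  · simp [hy hyK]

end Potential

/-! ### The unbounded component and the exterior maximum principle -/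

section Exterior

variable {n : ℕ}

theorem isPreconnected_setOf_lt_norm (hn : 2 ≤ n) {R : ℝ} (hR : 0 ≤ R) :
    IsPreconnected {x : EuclideanSpace ℝ (Fin n) | R < ‖x‖} := by
  have hrank : 1 < Module.rank ℝ (EuclideanSpace ℝ (Fin n)) := by
    rw [← Module.finrank_eq_rank, finrank_euclideanSpace_fin]
    exact_mod_cast hn
  have hc := (isConnected_compl_singleton_of_one_lt_rank hrank
    (0 : EuclideanSpace ℝ (Fin n))).isPreconnected
  -- The map pushes each point of the punctured space radially outward by `R`.
  have himage : {x : EuclideanSpace ℝ (Fin n) | R < ‖x‖}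
      = (fun y => (1 + R * ‖y‖⁻¹) • y) '' {0}ᶜ := by
    ext x
    constructor
    · intro hx
      have hx : R < ‖x‖ := hx
      have hx0 : 0 < ‖x‖ := hR.trans_lt hx
      have hxR : ‖x‖ - R ≠ 0 := (sub_pos.2 hx).ne'
      have hpos : 0 < 1 - R * ‖x‖⁻¹ := by
        rw [sub_pos, ← div_eq_mul_inv, div_lt_one hx0]; exact hx
      refine ⟨(1 - R * ‖x‖⁻¹) • x, ?_, ?_⟩
      · exact smul_ne_zero hpos.ne' (norm_pos_iff.1 hx0)
      · simp only [norm_smul, Real.norm_eq_abs, abs_of_pos hpos, smul_smul]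
        convert one_smul ℝ x using 2
        field_simp
        ring
    · rintro ⟨y, hy, rfl⟩
      have hy0 : 0 < ‖y‖ := norm_pos_iff.2 hy
      have : 0 ≤ 1 + R * ‖y‖⁻¹ := by positivity
      simp only [mem_ofPred_eq, norm_smul, Real.norm_eq_abs, abs_of_nonneg this]
      rw [add_mul, mul_assoc, inv_mul_cancel₀ hy0.ne']
      linarith
  rw [himage]
  refine hc.image _ ?_
  have : ∀ y ∈ ({0}ᶜ : Set (EuclideanSpace ℝ (Fin n))), ‖y‖ ≠ 0 := fun y hy => norm_ne_zero_iff.2 hy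
  fun_prop (disch := assumption)

theorem IsUnboundedComponent.setOf_lt_norm_subset (hn : 2 ≤ n)
    {S Ω : Set (EuclideanSpace ℝ (Fin n))} (hΩ : IsUnboundedComponent S Ω) {R : ℝ} (hR : 0 ≤ R)
    (hS : Sᶜ ⊆ Metric.closedBall 0 R) : {x | R < ‖x‖} ⊆ Ω := by
  obtain ⟨⟨x, hx, rfl⟩, hunb⟩ := hΩ
  obtain ⟨y, hy, hyR⟩ : ∃ y ∈ connectedComponentIn S x, R < ‖y‖ := by
    by_contra! h
    exact hunb (Metric.isBounded_closedBall.subset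
      fun y hy => mem_closedBall_zero_iff.2 (h y hy))
  rw [connectedComponentIn_eq hy]
  refine (isPreconnected_setOf_lt_norm hn hR).subset_connectedComponentIn hyR fun z hz => ?_
  by_contra hzS
  exact (mem_closedBall_zero_iff.1 (hS hzS)).not_gt hz

variable {u : EuclideanSpace ℝ (Fin n) → ℝ} {Ω : Set (EuclideanSpace ℝ (Fin n))}

/-- Maximum principle in an exterior domain for harmonic functions decaying like
`‖x‖ ^ (1 - n)`. -/
theorem exists_isMaxOn_frontier_isLUB (hn : 2 ≤ n) (hu : Continuous u) (hΩo : IsOpen Ω)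
    (hΩc : IsPreconnected Ω) (hΩuniv : Ω ≠ univ) {R C : ℝ} (hR : 0 ≤ R)
    (hext : {x | R < ‖x‖} ⊆ Ω) (hharm : ∀ x ∈ Ω, HasLimitLaplacian u x 0)
    (hdecay : ∀ x, R ≤ ‖x‖ → |u x| ≤ C * ‖x‖ ^ (1 - n : ℝ)) :
    ∃ x₀ ∈ frontier Ω, IsMaxOn u (frontier Ω) x₀ ∧ IsLUB (u '' Ω) (u x₀) := by
  obtain ⟨q, hqR, hq0⟩ := exists_mem_sphere_nonneg_of_decay hn hu (R := R + 1) (C := C)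
    (by positivity) (fun x hx => hharm x (hext (by rw [mem_ofPred_eq]; linarith)))
    (fun x hx => hdecay x (by linarith))
  have hqΩ : q ∈ Ω := hext (by rw [mem_ofPred_eq]; linarith)
  have hfr_sub : frontier Ω ⊆ Metric.closedBall 0 R := by
    intro x hx
    rw [mem_closedBall_zero_iff]
    by_contra! h
    exact (hΩo.frontier_eq ▸ hx : x ∈ closure Ω \ Ω).2 (hext h)
  have hfr_compact : IsCompact (frontier Ω) :=
    (isCompact_closedBall _ _).of_isClosed_subset isClosed_frontier hfr_sub
  have hfr_ne : (frontier Ω).Nonempty := nonempty_frontier_iff.2 ⟨⟨q, hqΩ⟩, hΩuniv⟩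
  obtain ⟨x₀, hx₀, hmax⟩ := hfr_compact.exists_isMaxOn hfr_ne hu.continuousOn
  have hx₀cl : x₀ ∈ closure Ω := frontier_subset_closure hx₀
  -- An interior maximum makes `u` constant on `Ω`, hence on its closure, which contains `x₀`.
  have hnot : ∀ p ∈ Ω, (∀ x ∈ Ω, u x ≤ u p) → u p ≤ u x₀ := by
    intro p hp hle
    have heq := eqOn_of_isMaxOn_of_hasLimitLaplacian hn hu hΩo hΩc hharm hp hle
    have : closure Ω ⊆ {x | u x = u p} :=
      closure_minimal heq (isClosed_eq hu continuous_const)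
    exact (this hx₀cl).ge
  refine ⟨x₀, hx₀, hmax, ?_, ?_⟩
  · rintro _ ⟨x, hx, rfl⟩
    by_contra! hgt
    -- A positive excess is attained, as `u → 0` confines it to a compact set. Otherwise values
    -- above `u x₀` are at most `0`, so `u x₀ < 0` and `q`, where `u q ≥ 0`, is an interior maximum.
    by_cases hpos : ∃ z ∈ Ω, u x₀ < u z ∧ 0 < u z
    · obtain ⟨z, hz, hz₁, hz₂⟩ := hpos
      obtain ⟨T, hT, hTsub⟩ := mem_cocompact.1
        ((tendsto_cocompact_zero_of_abs_le_rpow hn hdecay).eventually_lt_const hz₂)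
      have hzT : z ∈ T := by
        by_contra h
        exact lt_irrefl (u z) (hTsub h)
      obtain ⟨p, hp, hpmax⟩ := (hT.inter_left isClosed_closure).exists_isMaxOn
        ⟨z, subset_closure hz, hzT⟩ hu.continuousOn
      rw [isMaxOn_iff] at hpmax
      have hpz : u z ≤ u p := hpmax z ⟨subset_closure hz, hzT⟩
      have hpΩ : p ∈ Ω := by
        by_contra h
        have hpf : p ∈ frontier Ω := hΩo.frontier_eq ▸ (⟨hp.1, h⟩ : p ∈ closure Ω \ Ω)
        have := isMaxOn_iff.1 hmax p hpf
        linarith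
      have := hnot p hpΩ fun y hy => by
        by_cases hyT : y ∈ T
        · exact hpmax y ⟨subset_closure hy, hyT⟩
        · exact (le_of_lt (hTsub hyT)).trans hpz
      linarith
    · push Not at hpos
      have hM : u x₀ < 0 := hgt.trans_le (hpos x hx hgt)
      have := hnot q hqΩ fun y hy => by
        rcases le_or_gt (u y) (u x₀) with h | h
        · linarith
        · exact (hpos y hy h).trans hq0
      linarith
  · intro b hb
    have : closure Ω ⊆ {x | u x ≤ b} :=
      closure_minimal (fun x hx => hb (mem_image_of_mem u hx)) (isClosed_le hu continuous_const)
    exact this hx₀cl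

theorem exists_isMinOn_frontier_isGLB (hn : 2 ≤ n) (hu : Continuous u) (hΩo : IsOpen Ω)
    (hΩc : IsPreconnected Ω) (hΩuniv : Ω ≠ univ) {R C : ℝ} (hR : 0 ≤ R)
    (hext : {x | R < ‖x‖} ⊆ Ω) (hharm : ∀ x ∈ Ω, HasLimitLaplacian u x 0)
    (hdecay : ∀ x, R ≤ ‖x‖ → |u x| ≤ C * ‖x‖ ^ (1 - n : ℝ)) :
    ∃ x₁ ∈ frontier Ω, IsMinOn u (frontier Ω) x₁ ∧ IsGLB (u '' Ω) (u x₁) := by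
  obtain ⟨x₁, hx₁, hmax, hub, hlub⟩ := exists_isMaxOn_frontier_isLUB (u := fun x => -u x) hn hu.neg
    hΩo hΩc hΩuniv hR hext (fun x hx => by simpa using (hharm x hx).const_mul (-1))
    (fun x hx => by rw [abs_neg]; exact hdecay x hx)
  refine ⟨x₁, hx₁, by simpa using hmax.neg, ?_, fun b hb => ?_⟩
  · rintro _ ⟨x, hx, rfl⟩
    exact neg_le_neg_iff.1 (hub (mem_image_of_mem _ hx))
  · refine neg_le_neg_iff.1 (hlub ?_)
    rintro _ ⟨x, hx, rfl⟩
    exact neg_le_neg (hb (mem_image_of_mem _ hx))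

end Exterior

/-! ### Essential support -/

section EssentialSupport

variable {n : ℕ} {ω : EuclideanSpace ℝ (Fin n) → ℝ}

theorem ae_eq_zero_of_notMem_essentialSupport (ω : EuclideanSpace ℝ (Fin n) → ℝ) :
    ∀ᵐ x, x ∉ essentialSupport ω → ω x = 0 := by
  -- A countable subfamily covers the same union, so the null sets can be combined.
  obtain ⟨T, hTc, hTsub, hTeq⟩ := TopologicalSpace.isOpen_sUnion_countable
    {U | IsOpen U ∧ ∀ᵐ x ∂(volume.restrict U), ω x = 0} fun U hU => hU.1
  have h : ∀ᵐ x, ∀ U ∈ T, x ∈ U → ω x = 0 := (ae_ball_iff hTc).2 fun U hU =>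
    (ae_restrict_iff' (hTsub hU).1.measurableSet).1 (hTsub hU).2
  filter_upwards [h] with x hx hxS
  rw [essentialSupport, notMem_compl_iff, ← hTeq] at hxS
  obtain ⟨U, hU, hxU⟩ := hxS
  exact hx U hU hxU

theorem essentialSupport_nonempty (h : ¬ ∀ᵐ x, ω x = 0) : (essentialSupport ω).Nonempty := by
  by_contra hne
  rw [not_nonempty_iff_eq_empty] at hne
  refine h ?_
  filter_upwards [ae_eq_zero_of_notMem_essentialSupport ω] with x hx
  exact hx (by simp [hne])

end EssentialSupport

/-! ### The main theorem -/

theorem mainTheorem4 (n : ℕ) (hn : 2 ≤ n) (ω : EuclideanSpace ℝ (Fin n) → ℝ)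
    (hω_one : MemLp ω 1 volume) (hω_top : MemLp ω ⊤ volume)
    (hω_supp : IsCompact (essentialSupport ω))
    (hω_mean : ∫ x, ω x = 0)
    (Ω : Set (EuclideanSpace ℝ (Fin n)))
    (hΩ : IsUnboundedComponent (essentialSupport ω)ᶜ Ω) :
    -- the integral defining `ω * 𝒩` converges absolutely at every point
    ConvolutionExists ω (newtonianKernel n) (ContinuousLinearMap.lsmul ℝ ℝ) volume ∧
    -- the supremum over `Ω` is the maximum over `∂Ω`, the infimum over `Ω` the minimum over `∂Ω`
    (¬ (∀ᵐ x, ω x = 0) →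
      (∃ x₀ ∈ frontier Ω, IsMaxOn (newtonianPotential ω) (frontier Ω) x₀ ∧
        IsLUB (newtonianPotential ω '' Ω) (newtonianPotential ω x₀)) ∧
      (∃ x₁ ∈ frontier Ω, IsMinOn (newtonianPotential ω) (frontier Ω) x₁ ∧
        IsGLB (newtonianPotential ω '' Ω) (newtonianPotential ω x₁))) ∧
    -- if the potential is constant on `∂Ω`, then it is constant in `Ω`
    ((∃ c, ∀ x ∈ frontier Ω, newtonianPotential ω x = c) →
      ∃ c, ∀ x ∈ Ω, newtonianPotential ω x = c) := by

  have hn1 : 1 ≤ n := by omega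
  have hω : Integrable ω := memLp_one_iff_integrable.1 hω_one
  obtain ⟨W, hW⟩ : ∃ W, ∀ᵐ y, |ω y| ≤ W :=
    ⟨_, by simpa using ae_le_lpNorm_exponent_top hω_top⟩
  have hK := ae_eq_zero_of_notMem_essentialSupport ω
  obtain ⟨R, hR0, hR⟩ := hω_supp.isBounded.subset_closedBall_lt 0 0
  have hKc : IsClosed (essentialSupport ω) := hω_supp.isClosed
  have hu := continuous_newtonianPotential hn1 hω hW hR0 hR hK
  obtain ⟨C, hC⟩ := exists_abs_newtonianPotential_le hn1 hω hW hR0 hR hK hω_mean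
  -- The radius `2 * R` is the one from which the decay estimate holds.
  have hext := hΩ.setOf_lt_norm_subset hn (R := 2 * R) (by positivity)
    (by rw [compl_compl]; exact hR.trans (Metric.closedBall_subset_closedBall (by linarith)))
  obtain ⟨⟨x, hx, hΩx⟩, -⟩ := hΩ
  have hΩS : Ω ⊆ (essentialSupport ω)ᶜ := hΩx ▸ connectedComponentIn_subset _ _
  have hΩo : IsOpen Ω := hΩx ▸ hKc.isOpen_compl.connectedComponentIn
  have hΩc : IsPreconnected Ω := hΩx ▸ isPreconnected_connectedComponentIn
  have hharm : ∀ x ∈ Ω, HasLimitLaplacian (newtonianPotential ω) x 0 := fun x hx =>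
    hasLimitLaplacian_newtonianPotential hn1 hω hW hR0 hR hKc hK (hΩS hx)
  have hmain : ¬ (∀ᵐ x, ω x = 0) →
      (∃ x₀ ∈ frontier Ω, IsMaxOn (newtonianPotential ω) (frontier Ω) x₀ ∧
        IsLUB (newtonianPotential ω '' Ω) (newtonianPotential ω x₀)) ∧
      (∃ x₁ ∈ frontier Ω, IsMinOn (newtonianPotential ω) (frontier Ω) x₁ ∧
        IsGLB (newtonianPotential ω '' Ω) (newtonianPotential ω x₁)) := by
    intro hne
    have hΩuniv : Ω ≠ univ := by
      rintro rfl
      obtain ⟨y, hy⟩ := essentialSupport_nonempty hne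
      exact hΩS (mem_univ y) hy
    exact ⟨exists_isMaxOn_frontier_isLUB hn hu hΩo hΩc hΩuniv (by positivity) hext hharm hC,
      exists_isMinOn_frontier_isGLB hn hu hΩo hΩc hΩuniv (by positivity) hext hharm hC⟩
  refine ⟨fun x => ?_, hmain, ?_⟩
  · simpa [ConvolutionExistsAt] using integrable_mul_newtonianKernel hn1 hω hW hR0 hR hK x
  · rintro ⟨c, hc⟩
    by_cases hzero : ∀ᵐ x, ω x = 0
    · refine ⟨0, fun x _ => ?_⟩
      rw [newtonianPotential_apply]
      refine integral_eq_zero_of_ae ?_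
      filter_upwards [hzero] with y hy
      simp [hy]
    · obtain ⟨⟨x₀, hx₀, -, hlub⟩, ⟨x₁, hx₁, -, hglb⟩⟩ := hmain hzero
      rw [hc x₀ hx₀] at hlub
      rw [hc x₁ hx₁] at hglb
      exact ⟨c, fun x hx => le_antisymm (hlub.1 (mem_image_of_mem _ hx))
        (hglb.1 (mem_image_of_mem _ hx))⟩
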